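/- Fix integers $d\ge 1$, $m\ge 0$, proportions $0=\theta_0<\theta_1<\dots<\theta_m<\theta_{m+1}=1$, vectors $\boldsymbol\mu_1,\dots,\boldsymbol\mu_{m+1}\in\mathbb R^d$ with $\boldsymbol\mu_k\ne\boldsymbol\mu_{k+1}$ for $k\in\{1,\dots,m\}$, and $\sigma>0$. For each $n$ put $\tau_k=\lfloor\theta_k n\rfloor$ and observe $$\mathbf Y_i=\boldsymbol\epsilon_i+\boldsymbol\mu_k\qquad\text{for }\tau_{k-1}+1\le i\le\tau_k,\ k\in\{1,\dots,m+1\},$$ where $\boldsymbol\epsilon_1,\dots,\boldsymbol\epsilon_n$ are i.i.d. $N_d(\mathbf 0,\sigma^2 I)$. Let $\epsilon>0$, $\alpha>0$, let $v\ge\sigma^2$ be a constant, and let the penalty be $$\beta=v\,(d+1)(1+\epsilon)\log n ;$$ thus $v=1$ gives the penalty $(d+1)(1+\epsilon)\log n$ when $\sigma^2\le 1$ (in particular for noise normalised to unit variance), and $v=\sigma^2$ is allowed for every $\sigma>0$. Let $0=\hat\tau_0<\hat\tau_1<\dots<\hat\tau_{\hat m}<\hat\tau_{\hat m+1}=n$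 be estimated changepoints that minimise exactly, over all numbers $k\in\{0,\dots,n-1\}$ and all locations $0=t_0<t_1<\dots<t_k<t_{k+1}=n$, the penalised squared error loss $$\sum_{j=1}^{k+1}\Big[\sum_{i=t_{j-1}+1}^{t_j}\big\|\mathbf Y_i-\bar{\mathbf Y}_{t_{j-1}+1:t_j}\big\|^2+\beta\Big],$$ where $\bar{\mathbf Y}_{s:t}$ is the mean of $\mathbf Y_s,\dots,\mathbf Y_t$ (ties between minimisers may be broken in any way). Then $\mathbb P(\mathcal E_n^\alpha)\to 1$ as $n\to\infty$, where $$\mathcal E_n^\alpha=\Big\{\hat m=m;\ \max_{i=1,\dots,m}|\hat\tau_i-\tau_i|\le\big\lceil(\log n)^{1+\alpha}\big\rceil\Big\}.$$ -/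

import Mathlib

open MeasureTheory ProbabilityTheory Filter Topology

namespace Changepoint

noncomputable section

/-- Squared error loss of the segment `y_{s+1}, …, y_t` of a series of vectors in `ℝ^d`:
the sum of the squared Euclidean distances to the mean of the segment. -/
def segCost {d : ℕ} (y : ℕ → EuclideanSpace ℝ (Fin d)) (s t : ℕ) : ℝ :=
  ∑ i ∈ Finset.Ioc s t,
    ‖y i - ((t : ℝ) - (s : ℝ))⁻¹ • ∑ j ∈ Finset.Ioc s t, y j‖ ^ 2

/-- The last changepoint in `S` strictly before `t`, and `0` if there is none. -/
def prevChange (S : Finset ℕ) (t : ℕ) : ℕ :=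
  (S.filter (fun s => s < t)).sup id

/-- Penalised cost of the segmentation of `y_1, …, y_n` with set of changepoints
`S = {τ_1 < … < τ_k} ⊆ {1, …, n - 1}`: the sum over the `k + 1` segments
`(τ_{j-1}, τ_j]` (where `τ_0 = 0`, `τ_{k+1} = n`) of squared error loss plus `β`.
A segment is indexed by its right end point `t ∈ S ∪ {n}`. -/
def penalisedCost {d : ℕ} (y : ℕ → EuclideanSpace ℝ (Fin d)) (n : ℕ) (β : ℝ)
    (S : Finset ℕ) : ℝ :=
  ∑ t ∈ insert n S, (segCost y (prevChange S t) t + β)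

/-- `S` is a set of changepoints of `y_1, …, y_n` that minimises the penalised cost exactly,
over all numbers and all locations of changepoints. -/
def IsExactMinimiser {d : ℕ} (y : ℕ → EuclideanSpace ℝ (Fin d)) (n : ℕ) (β : ℝ)
    (S : Finset ℕ) : Prop :=
  S ⊆ Finset.Ioo 0 n ∧
    ∀ S' : Finset ℕ, S' ⊆ Finset.Ioo 0 n → penalisedCost y n β S ≤ penalisedCost y n β S'

/-- The `k`-th true changepoint `⌊θ_k n⌋` of a series of length `n`. -/
def trueChange {m : ℕ} (θ : Fin (m + 2) → ℝ) (n : ℕ) (k : Fin (m + 2)) : ℕ :=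
  ⌊θ k * (n : ℝ)⌋₊

/-- The estimated set of changepoints `S` has exactly `m` elements `τ̂_1 < … < τ̂_m`, and
`|τ̂_i - τ_i| ≤ ⌈(log n)^{1+α}⌉` for every `i = 1, …, m`. -/
def IsAccurate {m : ℕ} (θ : Fin (m + 2) → ℝ) (α : ℝ) (n : ℕ) (S : Finset ℕ) : Prop :=
  ∃ h : S.card = m, ∀ i : Fin m,
    |((S.orderEmbOfFin h i : ℕ) : ℤ) - (trueChange θ n i.succ.castSucc : ℤ)|
      ≤ ⌈(Real.log (n : ℝ)) ^ (1 + α)⌉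

end

end Changepoint

namespace Changepoint

/-! Write `L` for the window half-width `⌈(log n)^{1+α}⌉` and `β` for the penalty, of order `log n`.
A deterministic argument reduces accuracy to two noise bounds, and Chernoff bounds show that these
hold with probability tending to one.

No change is missed. If an exact minimiser had no point within `L` of a true change `τ`, adding `τ -
L`, `τ`, `τ + L` would cost at most `3β`. It would lower the residual sum by at least a multiple of
`L` times the squared jump, once the noise averages over the two adjacent blocks are below a quarter
of the jump. Since `L` outgrows `log n`, this contradicts minimality
(`IsExactMinimiser.normSq_sum_sub_sum_le`).

No change is superfluous. Pick one estimated change `p k` in each window and let `R` be the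
remaining ones. Comparison with the true segmentation `S₀` shows that the noise explained by the
segmentation `p ∪ R ∪ S₀` is at least `|R| β` (`IsExactMinimiser.excess_mul_le`). Block sums over
disjoint segments are independent Gaussians, so for `a σ² < 1/2` and `C = E exp(a‖Z‖²)` this has
probability at most `C^(2m+1) q^|R|` with `q = C exp(-aβ)`. There are at most `(2L+1)^m` choices of
`p`, a polylogarithmic number, and summing over nonempty `R` gives at most `exp(nq) - 1`
(`measure_exists_le_explainedNoise_le`). The penalty allows `aβ ≥ (1 + ε/2) log n`, so `nq` is of
order at most `n^(-ε/2)` and beats the polylogarithmic factor. Hence `R` is empty, and the estimated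
changes are exactly the `p k`. -/

/-! ### Exponential moments of isotropic Gaussian vectors. -/

/-- The exponential of `a x²` is integrable under the standard normal law when `a < 1/2`. -/
theorem integrable_exp_mul_sq_gaussianReal {a : ℝ} (ha : a < 1 / 2) :
    Integrable (fun x : ℝ => Real.exp (a * x ^ 2)) (gaussianReal 0 1) := by
  rw [gaussianReal_of_var_ne_zero 0 one_ne_zero,
    integrable_withDensity_iff (measurable_gaussianPDF 0 1)
      (Eventually.of_forall fun x => gaussianPDF_lt_top)]
  have h := (integrable_exp_neg_mul_sq (b := 1 / 2 - a) (by linarith)).const_mul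
    ((√(2 * Real.pi * 1))⁻¹)
  refine h.congr (Eventually.of_forall fun x => ?_)
  simp only [toReal_gaussianPDF, gaussianPDFReal, NNReal.coe_one, sub_zero]
  rw [mul_left_comm, ← Real.exp_add]
  congr 2
  ring

theorem integrable_exp_mul_normSq_stdGaussian {d : ℕ} {a : ℝ} (ha : a < 1 / 2) :
    Integrable (fun x : EuclideanSpace ℝ (Fin d) => Real.exp (a * ‖x‖ ^ 2))
      (stdGaussian (EuclideanSpace ℝ (Fin d))) := by
  rw [← map_pi_eq_stdGaussian, integrable_map_measure (by fun_prop) (by fun_prop)]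
  have h := Integrable.fintype_prod (ι := Fin d) (μ := fun _ => gaussianReal 0 1)
    (f := fun _ x => Real.exp (a * x ^ 2)) fun _ => integrable_exp_mul_sq_gaussianReal ha
  refine h.congr (Eventually.of_forall fun x => ?_)
  simp only [Function.comp_apply, EuclideanSpace.real_norm_sq_eq, ← Real.exp_sum, Finset.mul_sum]

theorem charFun_isotropicGaussian {d : ℕ} (σ : ℝ) (x : EuclideanSpace ℝ (Fin d)) :
    charFun (multivariateGaussian 0 (σ ^ 2 • (1 : Matrix (Fin d) (Fin d) ℝ))) x
      = Complex.exp (-((σ ^ 2 * ‖x‖ ^ 2 / 2 : ℝ) : ℂ)) := by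
  rw [charFun_multivariateGaussian (Matrix.PosSemidef.one.smul (sq_nonneg σ))]
  congr 1
  have : x.ofLp ⬝ᵥ x.ofLp = ‖x‖ ^ 2 := by
    rw [EuclideanSpace.real_norm_sq_eq]; simp [dotProduct, sq]
  simp [Matrix.smul_mulVec, this]

theorem isotropicGaussian_eq_map {d : ℕ} (σ : ℝ) :
    multivariateGaussian 0 (σ ^ 2 • (1 : Matrix (Fin d) (Fin d) ℝ))
      = (stdGaussian (EuclideanSpace ℝ (Fin d))).map (fun x => σ • x) := by
  have : IsProbabilityMeasure ((stdGaussian (EuclideanSpace ℝ (Fin d))).map (fun x => σ • x)) :=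
    Measure.isProbabilityMeasure_map (by fun_prop)
  apply Measure.ext_of_charFun
  ext t
  rw [charFun_isotropicGaussian, charFun_map_smul, charFun_stdGaussian, norm_smul]
  congr 1
  have : (‖σ‖ * ‖t‖) ^ 2 = σ ^ 2 * ‖t‖ ^ 2 := by rw [mul_pow, Real.norm_eq_abs, sq_abs]
  rw [← Complex.ofReal_pow, this]
  push_cast
  ring

theorem lintegral_exp_normSq_isotropicGaussian_lt_top {d : ℕ} {σ a : ℝ} (ha : a * σ ^ 2 < 1 / 2) :
    ∫⁻ x, ENNReal.ofReal (Real.exp (a * ‖x‖ ^ 2))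
      ∂(multivariateGaussian 0 (σ ^ 2 • (1 : Matrix (Fin d) (Fin d) ℝ))) < ⊤ := by
  rw [isotropicGaussian_eq_map, lintegral_map (by fun_prop) (by fun_prop)]
  have h := (integrable_exp_mul_normSq_stdGaussian (d := d) ha).lintegral_lt_top
  convert h using 5 with x
  rw [norm_smul, mul_pow, Real.norm_eq_abs, sq_abs]
  ring

/-! ### Chernoff bounds for sums over disjoint blocks of noise. -/

section Blocks

variable {ι Ω : Type*} [MeasurableSpace Ω] {P : Measure Ω} [IsProbabilityMeasure P] {d : ℕ}
  {X : ι → Ω → EuclideanSpace ℝ (Fin d)} {σ : ℝ}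

/-- The normalised sum of a block of independent isotropic Gaussian vectors
has the law of a single one. -/
theorem hasLaw_normalised_sum
    (hlaw : ∀ i, HasLaw (X i)
      (multivariateGaussian 0 (σ ^ 2 • (1 : Matrix (Fin d) (Fin d) ℝ))) P)
    (hind : iIndepFun X P) (B : Finset ι) (hB : B.Nonempty) :
    HasLaw (fun ω => (√(B.card : ℝ))⁻¹ • ∑ i ∈ B, X i ω)
      (multivariateGaussian 0 (σ ^ 2 • (1 : Matrix (Fin d) (Fin d) ℝ))) P := by
  have hm : AEMeasurable (fun ω => ∑ i ∈ B, X i ω) P :=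
    Finset.aemeasurable_fun_sum _ fun i _ => (hlaw i).aemeasurable
  have hm' : AEMeasurable (fun ω => (√(B.card : ℝ))⁻¹ • ∑ i ∈ B, X i ω) P :=
    hm.fun_const_smul _
  refine ⟨hm', ?_⟩
  have := Measure.isProbabilityMeasure_map hm'
  apply Measure.ext_of_charFun
  ext t
  have e : P.map (fun ω => (√(B.card : ℝ))⁻¹ • ∑ i ∈ B, X i ω)
      = (P.map (fun ω => ∑ i ∈ B, X i ω)).map (fun x => (√(B.card : ℝ))⁻¹ • x) := by
    rw [AEMeasurable.map_map_of_aemeasurable (by fun_prop) hm]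
    rfl
  have hr : iIndepFun (B.restrict X) P :=
    hind.precomp (g := fun i : B => (i : ι)) Subtype.val_injective
  rw [e, charFun_map_smul, iIndepFun.charFun_map_fun_finsetSum_eq_prod
    (fun i _ => (hlaw i).aemeasurable) hr, Finset.prod_apply]
  simp_rw [(hlaw _).map_eq, charFun_isotropicGaussian]
  rw [Finset.prod_const, ← Complex.exp_nat_mul, norm_smul, mul_pow, Real.norm_eq_abs, sq_abs,
    inv_pow, Real.sq_sqrt (Nat.cast_nonneg _)]
  have : (B.card : ℂ) ≠ 0 := by exact_mod_cast hB.card_pos.ne'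
  congr 1
  push_cast
  field_simp

/-- Disjoint blocks are independent, so the expectation factorises. Each factor is the moment of one
Gaussian vector whatever the block length, which makes later bounds depend only on the number of
segments. -/
theorem lintegral_exp_sum_normSq_blocks {κ : Type*}
    (hlaw : ∀ i, HasLaw (X i)
      (multivariateGaussian 0 (σ ^ 2 • (1 : Matrix (Fin d) (Fin d) ℝ))) P)
    (hind : iIndepFun X P) (a : ℝ) (B : κ → Finset ι) (T : Finset κ)
    (hB : ∀ t ∈ T, (B t).Nonempty)
    (hdisj : (T : Set κ).PairwiseDisjoint B) :
    ∫⁻ ω, ENNReal.ofReal (Real.exp (a * ∑ t ∈ T,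
        ‖(√((B t).card : ℝ))⁻¹ • ∑ i ∈ B t, X i ω‖ ^ 2)) ∂P
      = (∫⁻ x, ENNReal.ofReal (Real.exp (a * ‖x‖ ^ 2))
          ∂(multivariateGaussian 0 (σ ^ 2 • (1 : Matrix (Fin d) (Fin d) ℝ)))) ^ T.card := by
  classical
  induction T using Finset.induction_on with
  | empty => simp
  | insert s T hs ih =>
    rw [Finset.card_insert_of_notMem hs, pow_succ, ← ih (fun t ht => hB t (by simp [ht]))
      (hdisj.subset (by simp)), mul_comm,
      ← (hasLaw_normalised_sum hlaw hind (B s) (hB s (by simp))).lintegral_comp (by fun_prop)]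
    have hd : Disjoint (B s) (T.biUnion B) := by
      rw [Finset.disjoint_biUnion_right]
      intro t ht
      exact hdisj (by simp) (by simp [ht]) (by rintro rfl; exact hs ht)
    have hI := hind.indepFun_finset₀ (B s) (T.biUnion B) hd fun i => (hlaw i).aemeasurable
    let φ : (B s → EuclideanSpace ℝ (Fin d)) → ENNReal := fun x =>
      ENNReal.ofReal (Real.exp (a * ‖(√((B s).card : ℝ))⁻¹ • ∑ i, x i‖ ^ 2))
    -- The blocks are read off a vector indexed by their union; the default `0` is never reached, as
    -- each `B t` with `t ∈ T` lies in that union.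
    let ψ : (T.biUnion B → EuclideanSpace ℝ (Fin d)) → ENNReal := fun x =>
      ENNReal.ofReal (Real.exp (a * ∑ t ∈ T, ‖(√((B t).card : ℝ))⁻¹ •
        ∑ i ∈ B t, if h : i ∈ T.biUnion B then x ⟨i, h⟩ else 0‖ ^ 2))
    have hφ : Measurable φ := by fun_prop
    have hψ : Measurable ψ := by
      refine ENNReal.measurable_ofReal.comp (Real.measurable_exp.comp (measurable_const.mul ?_))
      refine Finset.measurable_fun_sum _ fun t _ => (Measurable.norm ?_).pow_const 2
      refine (Finset.measurable_fun_sum _ fun i _ => ?_).fun_const_smul _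
      split_ifs <;> fun_prop
    have h1 : (fun ω => ENNReal.ofReal (Real.exp (a *
        ‖(√((B s).card : ℝ))⁻¹ • ∑ i ∈ B s, X i ω‖ ^ 2)))
        = φ ∘ (fun ω (i : B s) => X i ω) := by
      funext ω
      simp only [φ, Function.comp_apply]
      rw [← Finset.sum_coe_sort]
    have h2 : (fun ω => ENNReal.ofReal (Real.exp (a * ∑ t ∈ T,
        ‖(√((B t).card : ℝ))⁻¹ • ∑ i ∈ B t, X i ω‖ ^ 2)))
        = ψ ∘ (fun ω (i : T.biUnion B) => X i ω) := by
      funext ω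
      simp only [ψ, Function.comp_apply]
      congr 3
      refine Finset.sum_congr rfl fun t ht => ?_
      congr 3
      refine Finset.sum_congr rfl fun i hi => ?_
      rw [dif_pos (Finset.mem_biUnion.2 ⟨t, ht, hi⟩)]
    have m1 : AEMeasurable (fun ω (i : B s) => X i ω) P :=
      aemeasurable_pi_lambda _ fun i => (hlaw i).aemeasurable
    have m2 : AEMeasurable (fun ω (i : T.biUnion B) => X i ω) P :=
      aemeasurable_pi_lambda _ fun i => (hlaw i).aemeasurable
    rw [h1, h2, ← lintegral_mul_eq_lintegral_mul_lintegral_of_indepFun''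
      (hφ.comp_aemeasurable m1) (hψ.comp_aemeasurable m2) (hI.comp hφ hψ), ← h1, ← h2]
    refine lintegral_congr fun ω => ?_
    rw [Finset.sum_insert hs, mul_add, Real.exp_add, ENNReal.ofReal_mul (Real.exp_pos _).le]

/-- Chernoff bound for the sum of the normalised squared block sums of Gaussian noise. -/
theorem measure_le_sum_normSq_blocks {κ : Type*}
    (hlaw : ∀ i, HasLaw (X i)
      (multivariateGaussian 0 (σ ^ 2 • (1 : Matrix (Fin d) (Fin d) ℝ))) P)
    (hind : iIndepFun X P) {a : ℝ} (ha : 0 ≤ a) (ha' : a * σ ^ 2 < 1 / 2) (x : ℝ)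
    (B : κ → Finset ι) (T : Finset κ)
    (hB : ∀ t ∈ T, (B t).Nonempty)
    (hdisj : (T : Set κ).PairwiseDisjoint B) :
    P {ω | x ≤ ∑ t ∈ T, ((B t).card : ℝ)⁻¹ * ‖∑ i ∈ B t, X i ω‖ ^ 2}
      ≤ ENNReal.ofReal ((∫⁻ x, ENNReal.ofReal (Real.exp (a * ‖x‖ ^ 2))
          ∂(multivariateGaussian 0 (σ ^ 2 • (1 : Matrix (Fin d) (Fin d) ℝ)))).toReal ^ T.card
          * Real.exp (-(a * x))) := by
  set C := ∫⁻ x, ENNReal.ofReal (Real.exp (a * ‖x‖ ^ 2))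
          ∂(multivariateGaussian 0 (σ ^ 2 • (1 : Matrix (Fin d) (Fin d) ℝ))) with hC
  have hCt : C ≠ ⊤ := (lintegral_exp_normSq_isotropicGaussian_lt_top ha').ne
  have hmeas : AEMeasurable (fun ω => ENNReal.ofReal (Real.exp (a * ∑ t ∈ T,
        ‖(√((B t).card : ℝ))⁻¹ • ∑ i ∈ B t, X i ω‖ ^ 2))) P := by
    refine ENNReal.measurable_ofReal.comp_aemeasurable (Real.measurable_exp.comp_aemeasurable
      (AEMeasurable.const_mul ?_ _))
    refine Finset.aemeasurable_fun_sum _ fun t _ => (AEMeasurable.norm ?_).pow_const 2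
    exact (Finset.aemeasurable_fun_sum _ fun i _ => (hlaw i).aemeasurable).fun_const_smul _
  -- Markov's inequality at level `exp(a x)`.
  have hM := meas_ge_le_lintegral_div hmeas (ε := ENNReal.ofReal (Real.exp (a * x)))
    (by simp [Real.exp_pos]) ENNReal.ofReal_ne_top
  rw [lintegral_exp_sum_normSq_blocks hlaw hind a B T hB hdisj, ← hC] at hM
  refine (measure_mono fun ω hω => ?_).trans (hM.trans_eq ?_)
  · simp only [Set.mem_ofPred_eq] at hω ⊢
    refine ENNReal.ofReal_le_ofReal (Real.exp_le_exp.2 (mul_le_mul_of_nonneg_left ?_ ha))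
    refine hω.trans_eq (Finset.sum_congr rfl fun t _ => ?_)
    rw [norm_smul, mul_pow, norm_inv, Real.norm_eq_abs, inv_pow, sq_abs,
      Real.sq_sqrt (Nat.cast_nonneg _)]
  · rw [ENNReal.ofReal_mul (by positivity), ENNReal.ofReal_pow ENNReal.toReal_nonneg,
      ENNReal.ofReal_toReal hCt, Real.exp_neg, ENNReal.ofReal_inv_of_pos (Real.exp_pos _),
      div_eq_mul_inv]

end Blocks

/-! ### Combinatorics of segmentations. -/

theorem prevChange_lt (S : Finset ℕ) {t : ℕ} (ht : 0 < t) : prevChange S t < t := by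
  rw [prevChange, Finset.sup_lt_iff (by simpa using ht)]
  intro s hs
  simpa using (Finset.mem_filter.1 hs).2

theorem le_prevChange {S : Finset ℕ} {s t : ℕ} (hs : s ∈ S) (hst : s < t) :
    s ≤ prevChange S t :=
  Finset.le_sup (f := id) (Finset.mem_filter.2 ⟨hs, hst⟩)

theorem prevChange_eq_of_mem {S : Finset ℕ} {s t : ℕ} (hs : s ∈ S) (hst : s < t)
    (h : ∀ r ∈ S, r < t → r ≤ s) : prevChange S t = s := by
  refine le_antisymm (Finset.sup_le fun r hr => ?_) (le_prevChange hs hst)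
  exact h r (Finset.mem_filter.1 hr).1 (Finset.mem_filter.1 hr).2

/-- A segment of the finer `T` has no point of `S` in its interior. Thus `prevChange S` labels the
segments of `S`, and any function of this label is constant on segments of `T`. -/
theorem prevChange_eq_of_mem_Ioc {S T : Finset ℕ} (hST : S ⊆ T) {i t : ℕ}
    (hi : i ∈ Finset.Ioc (prevChange T t) t) : prevChange S i = prevChange S t := by
  rw [Finset.mem_Ioc] at hi
  unfold prevChange
  congr 1
  ext s
  simp only [Finset.mem_filter, and_congr_right_iff]
  intro hs
  exact ⟨fun h => h.trans_le hi.2, fun h => (le_prevChange (hST hs) h).trans_lt hi.1⟩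

theorem pos_le_of_mem_insert {n : ℕ} {S : Finset ℕ} (hn : 0 < n) (hS : S ⊆ Finset.Ioo 0 n) {t : ℕ}
    (ht : t ∈ insert n S) : 0 < t ∧ t ≤ n := by
  rcases Finset.mem_insert.1 ht with rfl | ht
  · exact ⟨hn, le_rfl⟩
  · have := Finset.mem_Ioo.1 (hS ht)
    omega

/-- The segments of a segmentation are pairwise disjoint. -/
theorem pairwiseDisjoint_segments {n : ℕ} {S : Finset ℕ} (hn : 0 < n) (hS : S ⊆ Finset.Ioo 0 n) :
    ((insert n S : Finset ℕ) : Set ℕ).PairwiseDisjoint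
      fun t => Finset.Ioc (prevChange S t) t := by
  have key : ∀ s ∈ insert n S, ∀ t ∈ insert n S, s < t →
      Disjoint (Finset.Ioc (prevChange S s) s) (Finset.Ioc (prevChange S t) t) := by
    intro s hs t ht hst
    have hsS : s ∈ S := by
      rcases Finset.mem_insert.1 hs with rfl | h
      · have := (pos_le_of_mem_insert hn hS ht).2
        omega
      · exact h
    rw [Finset.disjoint_left]
    intro i hi hi'
    have := le_prevChange hsS hst
    rw [Finset.mem_Ioc] at hi hi'
    omega
  intro s hs t ht hst
  rcases lt_or_gt_of_ne hst with h | h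
  · exact key s hs t ht h
  · exact (key t ht s hs h).symm

/-- The segments of a segmentation cover `1, …, n`. -/
theorem biUnion_segments {n : ℕ} {S : Finset ℕ} (hn : 0 < n) (hS : S ⊆ Finset.Ioo 0 n) :
    (insert n S).biUnion (fun t => Finset.Ioc (prevChange S t) t) = Finset.Ioc 0 n := by
  ext i
  simp only [Finset.mem_biUnion, Finset.mem_Ioc]
  constructor
  · rintro ⟨t, ht, h1, h2⟩
    have := (pos_le_of_mem_insert hn hS ht).2
    omega
  · rintro ⟨h1, h2⟩
    -- The segment containing `i` ends at the least right end point `t ≥ i`; a previous change `≥ i`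
    -- would be a smaller one.
    have hne : ((insert n S).filter (i ≤ ·)).Nonempty := ⟨n, by simp [h2]⟩
    have hmem := Finset.mem_filter.1 (Finset.min'_mem _ hne)
    refine ⟨_, hmem.1, ?_, hmem.2⟩
    by_contra! hcon
    set t := ((insert n S).filter (i ≤ ·)).min' hne with ht
    have ht0 : 0 < t := by omega
    have hlt := prevChange_lt S ht0
    have hp : prevChange S t ∈ S := by
      have hS' : (S.filter (· < t)).Nonempty := by
        by_contra h
        rw [Finset.not_nonempty_iff_eq_empty] at h
        have : prevChange S t = 0 := by simp [prevChange, h]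
        omega
      obtain ⟨s, hs, h⟩ := Finset.exists_mem_eq_sup _ hS' id
      have e : prevChange S t = s := h
      rw [e]
      exact (Finset.mem_filter.1 hs).1
    have := Finset.min'_le ((insert n S).filter (i ≤ ·)) (prevChange S t) (by simp [hp, hcon])
    omega

theorem sum_segments {n : ℕ} {S : Finset ℕ} (hn : 0 < n) (hS : S ⊆ Finset.Ioo 0 n) (g : ℕ → ℝ) :
    ∑ t ∈ insert n S, ∑ i ∈ Finset.Ioc (prevChange S t) t, g i = ∑ i ∈ Finset.Ioc 0 n, g i := by
  rw [← biUnion_segments hn hS, Finset.sum_biUnion (pairwiseDisjoint_segments hn hS)]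

/-! ### Residual sums of squares under refinement. -/

section Cost

variable {d : ℕ} (y : ℕ → EuclideanSpace ℝ (Fin d))

/-- Bias-variance decomposition of the squared error of a constant fit on a segment. -/
theorem sum_normSq_sub_const {s t : ℕ} (hst : s < t) (c : EuclideanSpace ℝ (Fin d)) :
    ∑ i ∈ Finset.Ioc s t, ‖y i - c‖ ^ 2
      = segCost y s t + ((t : ℝ) - s)⁻¹ * ‖∑ i ∈ Finset.Ioc s t, (y i - c)‖ ^ 2 := by
  have hN : (0 : ℝ) < (t : ℝ) - s := sub_pos.2 (by exact_mod_cast hst)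
  have hcard : ((Finset.Ioc s t).card : ℝ) = (t : ℝ) - s := by
    rw [Nat.card_Ioc, Nat.cast_sub hst.le]
  set N : ℝ := (t : ℝ) - s
  set A := ∑ i ∈ Finset.Ioc s t, y i with hA
  have h1 : ∀ i, ‖y i - c‖ ^ 2 = ‖y i - N⁻¹ • A‖ ^ 2
      + 2 * inner ℝ (y i - N⁻¹ • A) (N⁻¹ • A - c) + ‖N⁻¹ • A - c‖ ^ 2 := by
    intro i
    rw [← norm_add_sq_real, sub_add_sub_cancel]
  have h2 : ∑ i ∈ Finset.Ioc s t, (y i - N⁻¹ • A) = 0 := by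
    rw [Finset.sum_sub_distrib, Finset.sum_const, ← Nat.cast_smul_eq_nsmul ℝ, hcard, smul_smul,
      mul_inv_cancel₀ hN.ne', one_smul, sub_self]
  have h3 : ∑ i ∈ Finset.Ioc s t, (y i - c) = N • (N⁻¹ • A - c) := by
    rw [Finset.sum_sub_distrib, Finset.sum_const, ← Nat.cast_smul_eq_nsmul ℝ, hcard, smul_sub,
      smul_smul, mul_inv_cancel₀ hN.ne', one_smul]
  rw [Finset.sum_congr rfl fun i _ => h1 i, Finset.sum_add_distrib, Finset.sum_add_distrib,
    ← Finset.mul_sum, ← sum_inner, h2, inner_zero_left, mul_zero, add_zero, Finset.sum_const,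
    nsmul_eq_mul, hcard, h3, norm_smul, Real.norm_of_nonneg hN.le, segCost]
  congr 1
  field_simp

/-- Residual sum of squares of the segmentation with changepoints `S`. -/
noncomputable def residualSum (n : ℕ) (S : Finset ℕ) : ℝ :=
  ∑ t ∈ insert n S, segCost y (prevChange S t) t

theorem penalisedCost_eq {n : ℕ} {S : Finset ℕ} (hS : S ⊆ Finset.Ioo 0 n) (β : ℝ) :
    penalisedCost y n β S = residualSum y n S + (S.card + 1) * β := by
  have hn : n ∉ S := fun h => by simpa using hS h
  rw [penalisedCost, Finset.sum_add_distrib, Finset.sum_const, Finset.card_insert_of_notMem hn,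
    residualSum, nsmul_eq_mul]
  push_cast
  rfl

theorem sum_normSq_sub_eq {n : ℕ} {T : Finset ℕ} (hn : 0 < n) (hT : T ⊆ Finset.Ioo 0 n)
    (f : ℕ → EuclideanSpace ℝ (Fin d))
    (hf : ∀ t ∈ insert n T, ∀ i ∈ Finset.Ioc (prevChange T t) t, f i = f t) :
    ∑ i ∈ Finset.Ioc 0 n, ‖y i - f i‖ ^ 2
      = residualSum y n T + ∑ t ∈ insert n T, ((t : ℝ) - prevChange T t)⁻¹ *
          ‖∑ i ∈ Finset.Ioc (prevChange T t) t, (y i - f i)‖ ^ 2 := by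
  rw [← sum_segments hn hT, residualSum, ← Finset.sum_add_distrib]
  refine Finset.sum_congr rfl fun t ht => ?_
  rw [Finset.sum_congr rfl fun i hi => by rw [hf t ht i hi],
    sum_normSq_sub_const y (prevChange_lt T (pos_le_of_mem_insert hn hT ht).1)]
  congr 4
  exact Finset.sum_congr rfl fun i hi => by rw [hf t ht i hi]

theorem segment_weight_nonneg {n : ℕ} {T : Finset ℕ} (hn : 0 < n) (hT : T ⊆ Finset.Ioo 0 n)
    {t : ℕ} (ht : t ∈ insert n T) : 0 ≤ ((t : ℝ) - prevChange T t)⁻¹ := by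
  have := prevChange_lt T (pos_le_of_mem_insert hn hT ht).1
  exact inv_nonneg.2 (sub_nonneg.2 (by exact_mod_cast this.le))

theorem residualSum_le_sum_normSq {n : ℕ} {T : Finset ℕ} (hn : 0 < n) (hT : T ⊆ Finset.Ioo 0 n)
    (f : ℕ → EuclideanSpace ℝ (Fin d))
    (hf : ∀ t ∈ insert n T, ∀ i ∈ Finset.Ioc (prevChange T t) t, f i = f t) :
    residualSum y n T ≤ ∑ i ∈ Finset.Ioc 0 n, ‖y i - f i‖ ^ 2 := by
  rw [sum_normSq_sub_eq y hn hT f hf]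
  exact le_add_of_nonneg_right <| Finset.sum_nonneg fun t ht =>
    mul_nonneg (segment_weight_nonneg hn hT ht) (sq_nonneg _)

/-- The residual sum of squares is attained by a fit that is constant on the segments. -/
theorem exists_residualSum_eq {n : ℕ} {S : Finset ℕ} (hn : 0 < n) (hS : S ⊆ Finset.Ioo 0 n) :
    ∃ c : ℕ → EuclideanSpace ℝ (Fin d),
      residualSum y n S = ∑ i ∈ Finset.Ioc 0 n, ‖y i - c (prevChange S i)‖ ^ 2 := by
  classical
  have hinj : ∀ s ∈ insert n S, ∀ t ∈ insert n S, prevChange S s = prevChange S t → s = t := by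
    intro s hs t ht h
    by_contra hne
    have h1 := prevChange_lt S (pos_le_of_mem_insert hn hS hs).1
    have h2 := prevChange_lt S (pos_le_of_mem_insert hn hS ht).1
    have hd : Disjoint (Finset.Ioc (prevChange S s) s) (Finset.Ioc (prevChange S t) t) :=
      pairwiseDisjoint_segments hn hS hs ht hne
    rw [Finset.disjoint_left] at hd
    exact hd (a := prevChange S s + 1) (Finset.mem_Ioc.2 (by omega)) (Finset.mem_Ioc.2 (by omega))
  -- The fit is indexed by the left end of a segment, which by `hinj` determines its right end; the
  -- value `0` elsewhere plays no role.
  refine ⟨fun p => if h : ∃ t ∈ insert n S, prevChange S t = p then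
    ((h.choose : ℝ) - (p : ℝ))⁻¹ • ∑ j ∈ Finset.Ioc p h.choose, y j else 0, ?_⟩
  rw [← sum_segments hn hS, residualSum]
  refine Finset.sum_congr rfl fun t ht => Finset.sum_congr rfl fun i hi => ?_
  rw [prevChange_eq_of_mem_Ioc subset_rfl hi]
  have h : ∃ s ∈ insert n S, prevChange S s = prevChange S t := ⟨t, ht, rfl⟩
  beta_reduce
  rw [dif_pos h, hinj _ h.choose_spec.1 t ht h.choose_spec.2]

/-- Refining a segmentation decreases the residual sum of squares. -/
theorem exists_residualSum_refine {n : ℕ} {S T : Finset ℕ} (hn : 0 < n) (hST : S ⊆ T)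
    (hT : T ⊆ Finset.Ioo 0 n) :
    ∃ c : ℕ → EuclideanSpace ℝ (Fin d), residualSum y n S = residualSum y n T
      + ∑ t ∈ insert n T, ((t : ℝ) - prevChange T t)⁻¹ *
          ‖∑ i ∈ Finset.Ioc (prevChange T t) t, (y i - c (prevChange S t))‖ ^ 2 := by
  obtain ⟨c, hc⟩ := exists_residualSum_eq y hn (hST.trans hT)
  refine ⟨c, ?_⟩
  rw [hc, sum_normSq_sub_eq y hn hT (fun i => c (prevChange S i))
    fun t _ i hi => by rw [prevChange_eq_of_mem_Ioc hST hi]]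
  congr 1
  refine Finset.sum_congr rfl fun t _ => ?_
  congr 3
  exact Finset.sum_congr rfl fun i hi => by rw [prevChange_eq_of_mem_Ioc hST hi]

theorem residualSum_anti {n : ℕ} {S T : Finset ℕ} (hn : 0 < n) (hST : S ⊆ T)
    (hT : T ⊆ Finset.Ioo 0 n) : residualSum y n T ≤ residualSum y n S := by
  obtain ⟨c, hc⟩ := exists_residualSum_refine y hn hST hT
  rw [hc]
  exact le_add_of_nonneg_right <| Finset.sum_nonneg fun t ht =>
    mul_nonneg (segment_weight_nonneg hn hT ht) (sq_nonneg _)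

/-! ### Deterministic consequences of exact minimality. -/

variable {y}

/-- If an exact minimiser has no changepoint within `L` of `τ`, then the means of the series
over the `L` times before and the `L` times after `τ` are close. -/
theorem IsExactMinimiser.normSq_sum_sub_sum_le {n : ℕ} {β : ℝ} {S : Finset ℕ}
    (hS : IsExactMinimiser y n β S) (hβ : 0 ≤ β) {τ L : ℕ} (hL : 0 < L) (hLτ : L < τ)
    (hτn : τ + L < n) (hfar : ∀ s ∈ S, s < τ - L ∨ τ + L < s) :
    (2 * (L : ℝ))⁻¹ * ‖∑ i ∈ Finset.Ioc (τ - L) τ, y i - ∑ i ∈ Finset.Ioc τ (τ + L), y i‖ ^ 2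
      ≤ 3 * β := by
  have hn : 0 < n := by omega
  -- These three points make the blocks `(τ - L, τ]` and `(τ, τ + L]` segments of `T`, while both
  -- lie in one segment of `S` and so share one fitted constant.
  set T : Finset ℕ := S ∪ {τ - L, τ, τ + L} with hTdef
  have hmem : ∀ r, r ∈ T ↔ r ∈ S ∨ r = τ - L ∨ r = τ ∨ r = τ + L := by
    intro r; simp only [T, Finset.mem_union, Finset.mem_insert, Finset.mem_singleton]
  have hST : S ⊆ T := Finset.subset_union_left
  have hT : T ⊆ Finset.Ioo 0 n := by
    intro r hr
    rcases (hmem r).1 hr with h | h | h | h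
    · exact hS.1 h
    all_goals rw [Finset.mem_Ioo]; omega
  have hcard : T.card ≤ S.card + 3 :=
    (Finset.card_union_le _ _).trans (Nat.add_le_add_left Finset.card_le_three _)
  have hp1 : prevChange T τ = τ - L := by
    refine prevChange_eq_of_mem ((hmem _).2 (by simp)) (by omega) fun r hr hrt => ?_
    rcases (hmem r).1 hr with h | h
    · have := hfar r h
      omega
    · omega
  have hp2 : prevChange T (τ + L) = τ := by
    refine prevChange_eq_of_mem ((hmem _).2 (by simp)) (by omega) fun r hr hrt => ?_
    rcases (hmem r).1 hr with h | h
    · have := hfar r h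
      omega
    · omega
  have hp3 : prevChange S τ = prevChange S (τ + L) := by
    unfold prevChange
    congr 1
    ext s
    simp only [Finset.mem_filter, and_congr_right_iff]
    intro hs
    have := hfar s hs
    omega
  obtain ⟨c, hc⟩ := exists_residualSum_refine y hn hST hT
  have hmin := hS.2 T hT
  rw [penalisedCost_eq y hS.1, penalisedCost_eq y hT, hc] at hmin
  set g : ℕ → ℝ := fun t => ((t : ℝ) - prevChange T t)⁻¹ *
          ‖∑ i ∈ Finset.Ioc (prevChange T t) t, (y i - c (prevChange S t))‖ ^ 2 with hg
  have hsub : ({τ, τ + L} : Finset ℕ) ⊆ insert n T := by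
    intro r hr
    rw [Finset.mem_insert, hmem]
    simp only [Finset.mem_insert, Finset.mem_singleton] at hr
    omega
  have hge : g τ + g (τ + L) ≤ ∑ t ∈ insert n T, g t := by
    rw [← Finset.sum_pair (f := g) (by omega : τ ≠ τ + L)]
    exact Finset.sum_le_sum_of_subset_of_nonneg hsub fun t ht _ =>
      mul_nonneg (segment_weight_nonneg hn hT ht) (sq_nonneg _)
  have hLr : (0 : ℝ) < L := by exact_mod_cast hL
  have hcast : ((τ : ℝ) - ((τ - L : ℕ) : ℝ)) = L := by
    rw [Nat.cast_sub hLτ.le]; ring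
  have hcast' : (((τ + L : ℕ) : ℝ) - (τ : ℝ)) = L := by
    push_cast; ring
  simp only [hg] at hge
  rw [hp1, hp2, hp3, hcast, hcast'] at hge
  set a := ∑ i ∈ Finset.Ioc (τ - L) τ, (y i - c (prevChange S (τ + L))) with ha
  set b := ∑ i ∈ Finset.Ioc τ (τ + L), (y i - c (prevChange S (τ + L))) with hb
  -- The blocks have equal length, so the common constant cancels in the difference.
  have hab : ∑ i ∈ Finset.Ioc (τ - L) τ, y i - ∑ i ∈ Finset.Ioc τ (τ + L), y i = a - b := by
    rw [ha, hb, Finset.sum_sub_distrib, Finset.sum_sub_distrib, Finset.sum_const, Finset.sum_const,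
      Nat.card_Ioc, Nat.card_Ioc, (by omega : τ - (τ - L) = L), (by omega : τ + L - τ = L)]
    abel
  have hpar : ‖a - b‖ ^ 2 ≤ 2 * (‖a‖ ^ 2 + ‖b‖ ^ 2) := by
    have := norm_sub_le a b
    nlinarith [norm_nonneg (a - b), sq_nonneg (‖a‖ - ‖b‖)]
  rw [hab]
  have hcr : (T.card : ℝ) ≤ S.card + 3 := by exact_mod_cast hcard
  have h1 : (2 * (L : ℝ))⁻¹ * ‖a - b‖ ^ 2 ≤ (L : ℝ)⁻¹ * ‖a‖ ^ 2 + (L : ℝ)⁻¹ * ‖b‖ ^ 2 := by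
    rw [← mul_add, mul_inv, mul_comm (2 : ℝ)⁻¹, mul_assoc]
    exact mul_le_mul_of_nonneg_left (by linarith) (inv_nonneg.2 hLr.le)
  have h2 := mul_le_mul_of_nonneg_right hcr hβ
  linarith

/-- The penalty of the excess changepoints of an exact minimiser, relative to a segmentation `S₀`
on which the signal `f` is constant, is at most the variation of the noise explained by the
common refinement. -/
theorem IsExactMinimiser.excess_mul_le {n : ℕ} {β : ℝ} {S S₀ : Finset ℕ}
    (hS : IsExactMinimiser y n β S) (hn : 0 < n) (hS₀ : S₀ ⊆ Finset.Ioo 0 n)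
    (f : ℕ → EuclideanSpace ℝ (Fin d))
    (hf : ∀ i ∈ Finset.Ioc 0 n, ∀ j ∈ Finset.Ioc 0 n,
      prevChange S₀ i = prevChange S₀ j → f i = f j) :
    ((S.card : ℝ) - S₀.card) * β ≤ ∑ t ∈ insert n (S ∪ S₀), ((t : ℝ) - prevChange (S ∪ S₀) t)⁻¹ *
          ‖∑ i ∈ Finset.Ioc (prevChange (S ∪ S₀) t) t, (y i - f i)‖ ^ 2 := by
  have hT : S ∪ S₀ ⊆ Finset.Ioo 0 n := Finset.union_subset hS.1 hS₀
  have hconst : ∀ T : Finset ℕ, S₀ ⊆ T → T ⊆ Finset.Ioo 0 n → ∀ t ∈ insert n T,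
      ∀ i ∈ Finset.Ioc (prevChange T t) t, f i = f t := by
    intro T hST hT t ht i hi
    have h1 := pos_le_of_mem_insert hn hT ht
    have h2 := Finset.mem_Ioc.1 hi
    exact hf i (Finset.mem_Ioc.2 (by omega)) t (Finset.mem_Ioc.2 h1)
      (prevChange_eq_of_mem_Ioc hST hi)
  -- The signal `f` is admissible for `S₀`, and its error splits on `S ∪ S₀` into the residual and
  -- the explained noise. As the residual of `S ∪ S₀` is at most that of `S`, comparing the
  -- penalised costs of `S` and `S₀` finishes.
  have h1 := residualSum_le_sum_normSq y hn hS₀ f (hconst S₀ subset_rfl hS₀)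
  rw [sum_normSq_sub_eq y hn hT f (hconst _ Finset.subset_union_right hT)] at h1
  have h2 := residualSum_anti y hn Finset.subset_union_left hT
  have h3 := hS.2 S₀ hS₀
  rw [penalisedCost_eq y hS.1, penalisedCost_eq y hS₀] at h3
  linarith

end Cost

/-! ### From noise bounds to accuracy of the minimiser. -/

/-- The sum over the segments of a segmentation of the squared noise sum divided by the length. -/
noncomputable def explainedNoise {d : ℕ} (ν : ℕ → EuclideanSpace ℝ (Fin d)) (n : ℕ)
    (T : Finset ℕ) : ℝ :=
  ∑ t ∈ insert n T, ((t : ℝ) - prevChange T t)⁻¹ *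
    ‖∑ i ∈ Finset.Ioc (prevChange T t) t, ν i‖ ^ 2

theorem exists_segment_of_mem {m n i : ℕ} {τ : Fin (m + 2) → ℕ} (h0 : τ 0 = 0)
    (hn : τ (Fin.last (m + 1)) = n) (hi : i ∈ Finset.Ioc 0 n) :
    ∃ k : Fin (m + 1), τ k.castSucc < i ∧ i ≤ τ k.succ := by
  rw [Finset.mem_Ioc] at hi
  by_contra! h
  have : ∀ k : Fin (m + 2), τ k < i := by
    intro k
    induction k using Fin.induction with
    | zero => omega
    | succ k ih => exact h k ih
  have := this (Fin.last _)
  omega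

/-- Accuracy of an exact minimiser, given that the noise is small around each true changepoint and
that no segmentation hitting the windows around the true changepoints explains too much noise. -/
theorem IsExactMinimiser.exists_card_eq_of_noise_bounds {d m n L : ℕ} {τ : Fin (m + 2) → ℕ}
    (hL : 0 < L) (h0 : τ 0 = 0) (hn : τ (Fin.last (m + 1)) = n)
    (hsep : ∀ k : Fin (m + 1), τ k.castSucc + 2 * L < τ k.succ)
    {y ν : ℕ → EuclideanSpace ℝ (Fin d)} {mean : Fin (m + 1) → EuclideanSpace ℝ (Fin d)}
    (hy : ∀ k : Fin (m + 1), ∀ i, τ k.castSucc + 1 ≤ i → i ≤ τ k.succ → y i = ν i + mean k)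
    {β : ℝ} (hβ : 0 ≤ β) {S : Finset ℕ} (hS : IsExactMinimiser y n β S)
    (hgain : ∀ k : Fin m, 3 * β < (L : ℝ) / 8 * ‖mean k.castSucc - mean k.succ‖ ^ 2)
    (hleft : ∀ k : Fin m, (L : ℝ)⁻¹ *
      ‖∑ i ∈ Finset.Ioc (τ k.succ.castSucc - L) (τ k.succ.castSucc), ν i‖ ^ 2
        < L * (‖mean k.castSucc - mean k.succ‖ / 4) ^ 2)
    (hright : ∀ k : Fin m, (L : ℝ)⁻¹ *
      ‖∑ i ∈ Finset.Ioc (τ k.succ.castSucc) (τ k.succ.castSucc + L), ν i‖ ^ 2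
        < L * (‖mean k.castSucc - mean k.succ‖ / 4) ^ 2)
    (hexcess : ∀ p ∈ Fintype.piFinset fun k : Fin m =>
        Finset.Icc (τ k.succ.castSucc - L) (τ k.succ.castSucc + L),
      ∀ R ⊆ Finset.Ioo 0 n, R.Nonempty →
        explainedNoise ν n ((Finset.univ.image p ∪ R) ∪
          Finset.univ.image fun k : Fin m => τ k.succ.castSucc) < R.card * β) :
    ∃ h : S.card = m, ∀ k : Fin m,
      |((S.orderEmbOfFin h k : ℕ) : ℤ) - (τ k.succ.castSucc : ℤ)| ≤ L := by
  have hmono : StrictMono τ := Fin.strictMono_iff_lt_succ.2 fun k => by have := hsep k; omega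
  have hsep₁ : ∀ k : Fin m, τ k.castSucc.castSucc + 2 * L < τ k.succ.castSucc := fun k => by
    rw [← Fin.succ_castSucc]; exact hsep _
  have hsep₂ : ∀ k : Fin m, τ k.succ.castSucc + 2 * L < τ k.succ.succ := fun k => hsep _
  have hle : ∀ k, τ k ≤ n := fun k => hn ▸ hmono.monotone (Fin.le_last k)
  have hnpos : 0 < n := by have := hsep 0; have := hle (Fin.succ 0); omega
  have hLr : (0 : ℝ) < L := by exact_mod_cast hL
  set S₀ : Finset ℕ := Finset.univ.image fun k : Fin m => τ k.succ.castSucc with hS₀def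
  have hS₀ : S₀ ⊆ Finset.Ioo 0 n := by
    intro s hs
    obtain ⟨k, -, rfl⟩ := Finset.mem_image.1 hs
    have h1 := hsep₁ k
    have h2 := hsep₂ k
    have h3 := hle k.succ.succ
    rw [Finset.mem_Ioo]
    omega
  have hS₀card : S₀.card = m := by
    rw [hS₀def, Finset.card_image_of_injective, Finset.card_univ, Fintype.card_fin]
    exact hmono.injective.comp ((Fin.castSucc_injective _).comp (Fin.succ_injective _))
  have hhit : ∀ k : Fin m, ∃ s ∈ S, τ k.succ.castSucc - L ≤ s ∧ s ≤ τ k.succ.castSucc + L := by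
    intro k
    by_contra! hcon
    have h1 := hsep₁ k
    have h2 := hsep₂ k
    have h3 := hle k.succ.succ
    have hbound := hS.normSq_sum_sub_sum_le hβ hL (τ := τ k.succ.castSucc) (by omega) (by omega)
      fun s hs => by
        by_cases h : τ k.succ.castSucc - L ≤ s
        · exact Or.inr (hcon s hs h)
        · exact Or.inl (by omega)
    have hl := hleft k
    have hr := hright k
    have hg := hgain k
    set t := τ k.succ.castSucc with ht
    have eL : ∑ i ∈ Finset.Ioc (t - L) t, y i
        = ∑ i ∈ Finset.Ioc (t - L) t, ν i + (L : ℝ) • mean k.castSucc := by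
      rw [Finset.sum_congr rfl fun i hi => hy k.castSucc i (by
          have := Finset.mem_Ioc.1 hi; omega) (by
          have := Finset.mem_Ioc.1 hi; rw [Fin.succ_castSucc]; omega),
        Finset.sum_add_distrib, Finset.sum_const, Nat.card_Ioc, Nat.cast_smul_eq_nsmul,
        (by omega : t - (t - L) = L)]
    have eR : ∑ i ∈ Finset.Ioc t (t + L), y i
        = ∑ i ∈ Finset.Ioc t (t + L), ν i + (L : ℝ) • mean k.succ := by
      rw [Finset.sum_congr rfl fun i hi => hy k.succ i (by
          have := Finset.mem_Ioc.1 hi; omega) (by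
          have := Finset.mem_Ioc.1 hi; omega),
        Finset.sum_add_distrib, Finset.sum_const, Nat.card_Ioc, Nat.cast_smul_eq_nsmul,
        (by omega : t + L - t = L)]
    rw [eL, eR] at hbound
    set a := ∑ i ∈ Finset.Ioc (t - L) t, ν i
    set b := ∑ i ∈ Finset.Ioc t (t + L), ν i
    set Δ := ‖mean k.castSucc - mean k.succ‖ with hΔ
    have hΔ0 : 0 ≤ Δ := norm_nonneg _
    have hsmall : ∀ x : EuclideanSpace ℝ (Fin d), (L : ℝ)⁻¹ * ‖x‖ ^ 2 < L * (Δ / 4) ^ 2 →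
        ‖x‖ < L * (Δ / 4) := by
      intro x hx
      rw [inv_mul_lt_iff₀ hLr, ← mul_assoc, ← sq, ← mul_pow] at hx
      exact lt_of_pow_lt_pow_left₀ 2 (by positivity) hx
    have ha := hsmall a hl
    have hb := hsmall b hr
    -- Each noise sum takes away at most `LΔ/4`, so the block sums differ by at least `LΔ/2`.
    -- Squaring and dividing by `2L` gives the `LΔ²/8` of `hgain`, which exceeds `3β`.
    have hnorm : (L : ℝ) * Δ ≤ ‖a + (L : ℝ) • mean k.castSucc - (b + (L : ℝ) • mean k.succ)‖
        + ‖a‖ + ‖b‖ := by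
      have e : (L : ℝ) • (mean k.castSucc - mean k.succ)
          = (a + (L : ℝ) • mean k.castSucc - (b + (L : ℝ) • mean k.succ)) - a + b := by
        rw [smul_sub]; abel
      have e2 : ‖(L : ℝ) • (mean k.castSucc - mean k.succ)‖ = L * Δ := by
        rw [norm_smul, Real.norm_of_nonneg hLr.le]
      rw [← e2, e]
      exact (norm_add_le _ _).trans (add_le_add_left (norm_sub_le _ _) _)
    have hD : (L : ℝ) * Δ / 2 ≤ ‖a + (L : ℝ) • mean k.castSucc - (b + (L : ℝ) • mean k.succ)‖ := by
      linarith
    have hD2 := pow_le_pow_left₀ (by positivity) hD 2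
    have hD3 := mul_le_mul_of_nonneg_left hD2 (by positivity : 0 ≤ (2 * (L : ℝ))⁻¹)
    have e3 : (2 * (L : ℝ))⁻¹ * ((L : ℝ) * Δ / 2) ^ 2 = (L : ℝ) / 8 * Δ ^ 2 := by
      field_simp
      ring
    linarith
  choose p hpS hpl hpr using hhit
  -- The windows are disjoint because consecutive true changes are more than `2L` apart.
  have hpmono : StrictMono p := by
    intro k l hkl
    have h1 := hsep₂ k
    have h2 : τ k.succ.succ ≤ τ l.succ.castSucc := hmono.monotone (by
      rw [Fin.le_iff_val_le_val]
      simp only [Fin.val_succ, Fin.val_castSucc]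
      have := Fin.lt_def.1 hkl
      omega)
    have h3 := hpr k
    have h4 := hpl l
    omega
  set I : Finset ℕ := Finset.univ.image p with hI
  have hIS : I ⊆ S := by
    intro s hs
    obtain ⟨k, -, rfl⟩ := Finset.mem_image.1 hs
    exact hpS k
  have hIcard : I.card = m := by
    rw [hI, Finset.card_image_of_injective _ hpmono.injective, Finset.card_univ, Fintype.card_fin]
  have hR : ¬ (S \ I).Nonempty := by
    intro hne
    have h1 := hexcess p (Fintype.mem_piFinset.2 fun k => Finset.mem_Icc.2 ⟨hpl k, hpr k⟩)
      (S \ I) (Finset.sdiff_subset.trans hS.1) hne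
    rw [Finset.union_sdiff_of_subset hIS, Finset.card_sdiff_of_subset hIS, hIcard,
      Nat.cast_sub (hIcard ▸ Finset.card_le_card hIS)] at h1
    have h2 := hS.excess_mul_le hnpos hS₀ (fun i => y i - ν i) (by
      intro i hi j hj hij
      obtain ⟨k, hk1, hk2⟩ := exists_segment_of_mem h0 hn hi
      obtain ⟨l, hl1, hl2⟩ := exists_segment_of_mem h0 hn hj
      -- Equal labels under `S₀` force equal true segments: a true change between `i` and `j` would
      -- separate their labels. Hence the signal `y - ν` is constant wherever the label is.
      have key : ∀ (i j : ℕ) (k l : Fin (m + 1)), 0 < i → i ≤ τ k.succ → τ l.castSucc < j →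
          prevChange S₀ i = prevChange S₀ j → ¬ k < l := by
        intro i j k l hi hi2 hj hij hkl
        obtain ⟨l', rfl⟩ := Fin.exists_succ_eq.2 (Fin.ne_zero_of_lt hkl)
        have h1 : τ l'.succ.castSucc ≤ prevChange S₀ j :=
          le_prevChange (Finset.mem_image.2 ⟨l', Finset.mem_univ _, rfl⟩) hj
        have h2 : τ k.succ ≤ τ l'.succ.castSucc := hmono.monotone (by
          rw [Fin.le_iff_val_le_val]
          have := Fin.lt_def.1 hkl
          simp only [Fin.val_succ, Fin.val_castSucc] at this ⊢
          omega)
        have h3 := prevChange_lt S₀ hi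
        omega
      have hkl : k = l := le_antisymm
        (not_lt.1 (key j i l k (by omega) hl2 hk1 hij.symm))
        (not_lt.1 (key i j k l (by omega) hk2 hl1 hij))
      subst hkl
      simp only [hy k i hk1 hk2, hy k j hl1 hl2, add_sub_cancel_left])
    simp only [sub_sub_cancel, hS₀card] at h2
    rw [explainedNoise] at h1
    linarith
  have hSI : S = I := by
    rw [Finset.not_nonempty_iff_eq_empty, Finset.sdiff_eq_empty_iff_subset] at hR
    exact hR.antisymm hIS
  have hcard : S.card = m := hSI ▸ hIcard
  refine ⟨hcard, fun k => ?_⟩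
  -- A strictly increasing enumeration of `S` by `Fin m` is unique, so the `k`-th estimated change
  -- is `p k`.
  rw [← Finset.orderEmbOfFin_unique hcard hpS hpmono, abs_le]
  have := hpl k
  have := hpr k
  omega

/-! ### Tail bounds for the noise and the union bound over segmentations. -/

/-- The exponential moment `E exp(a ‖Z‖²)` of an isotropic Gaussian vector `Z ~ N_d(0, σ² I)`. -/
noncomputable def expMoment (d : ℕ) (σ a : ℝ) : ℝ :=
  (∫⁻ x, ENNReal.ofReal (Real.exp (a * ‖x‖ ^ 2))
    ∂(multivariateGaussian 0 (σ ^ 2 • (1 : Matrix (Fin d) (Fin d) ℝ)))).toReal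

/-- Allows the exponent of `expMoment` to be replaced by any upper bound on the number of segments.
-/
theorem one_le_expMoment {d : ℕ} {σ a : ℝ} (ha : 0 ≤ a) (ha' : a * σ ^ 2 < 1 / 2) :
    1 ≤ expMoment d σ a := by
  rw [expMoment, ← ENNReal.toReal_one]
  refine ENNReal.toReal_mono (lintegral_exp_normSq_isotropicGaussian_lt_top ha').ne ?_
  have h : ∫⁻ _, (1 : ENNReal)
      ∂(multivariateGaussian 0 (σ ^ 2 • (1 : Matrix (Fin d) (Fin d) ℝ))) = 1 := by simp
  rw [← h]
  refine lintegral_mono fun x => ?_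
  rw [ENNReal.one_le_ofReal]
  exact Real.one_le_exp (by positivity)

section Noise

variable {Ω : Type*} [MeasurableSpace Ω] {P : Measure Ω} [IsProbabilityMeasure P] {d n : ℕ}
  {ν : ℕ → Ω → EuclideanSpace ℝ (Fin d)} {σ : ℝ}

/-- Law and independence are known only at times `1, …, n`, so the segments are transported to
blocks in that subtype before the Chernoff bound applies. -/
theorem measure_le_sum_segments_le
    (hlaw : ∀ i ∈ Finset.Icc 1 n, HasLaw (ν i)
      (multivariateGaussian 0 (σ ^ 2 • (1 : Matrix (Fin d) (Fin d) ℝ))) P)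
    (hind : iIndepFun (fun i : Finset.Icc 1 n => ν (i : ℕ)) P)
    {a : ℝ} (ha : 0 ≤ a) (ha' : a * σ ^ 2 < 1 / 2) (x : ℝ) (s : ℕ → ℕ) (T : Finset ℕ)
    (hs : ∀ t ∈ T, s t < t) (hT : ∀ t ∈ T, t ≤ n)
    (hdisj : (T : Set ℕ).PairwiseDisjoint fun t => Finset.Ioc (s t) t) :
    P {ω | x ≤ ∑ t ∈ T, ((t : ℝ) - s t)⁻¹ * ‖∑ i ∈ Finset.Ioc (s t) t, ν i ω‖ ^ 2}
      ≤ ENNReal.ofReal (expMoment d σ a ^ T.card * Real.exp (-(a * x))) := by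
  let B : ℕ → Finset (Finset.Icc 1 n) := fun t =>
    (Finset.Ioc (s t) t).subtype (· ∈ Finset.Icc 1 n)
  have hmem : ∀ t ∈ T, ∀ i ∈ Finset.Ioc (s t) t, i ∈ Finset.Icc 1 n := by
    intro t ht i hi
    have := hT t ht
    rw [Finset.mem_Ioc] at hi
    rw [Finset.mem_Icc]
    omega
  have hcard : ∀ t ∈ T, ((B t).card : ℝ) = (t : ℝ) - s t := by
    intro t ht
    rw [Finset.card_subtype, Finset.filter_true_of_mem (hmem t ht), Nat.card_Ioc,
      Nat.cast_sub (hs t ht).le]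
  have h := measure_le_sum_normSq_blocks (X := fun i : Finset.Icc 1 n => ν (i : ℕ))
    (fun i => hlaw i i.2) hind ha ha' x B T
    (fun t ht => ⟨⟨t, hmem t ht t (Finset.mem_Ioc.2 ⟨hs t ht, le_rfl⟩)⟩,
      Finset.mem_subtype.2 (Finset.mem_Ioc.2 ⟨hs t ht, le_rfl⟩)⟩)
    (fun t ht u hu htu => by
      have hd : Disjoint (Finset.Ioc (s t) t) (Finset.Ioc (s u) u) := hdisj ht hu htu
      rw [Finset.disjoint_left] at hd
      refine Finset.disjoint_left.2 fun i hi hi' => ?_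
      exact hd (Finset.mem_subtype.1 hi) (Finset.mem_subtype.1 hi'))
  refine (measure_mono fun ω hω => ?_).trans h
  simp only [Set.mem_ofPred_eq] at hω ⊢
  refine hω.trans_eq (Finset.sum_congr rfl fun t ht => ?_)
  rw [hcard t ht, Finset.sum_subtype_of_mem (fun i => ν i ω) (hmem t ht)]

theorem measure_le_explainedNoise_le
    (hlaw : ∀ i ∈ Finset.Icc 1 n, HasLaw (ν i)
      (multivariateGaussian 0 (σ ^ 2 • (1 : Matrix (Fin d) (Fin d) ℝ))) P)
    (hind : iIndepFun (fun i : Finset.Icc 1 n => ν (i : ℕ)) P)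
    {a : ℝ} (ha : 0 ≤ a) (ha' : a * σ ^ 2 < 1 / 2) (x : ℝ) (hn : 0 < n) {T : Finset ℕ}
    (hT : T ⊆ Finset.Ioo 0 n) {N : ℕ} (hN : T.card + 1 ≤ N) :
    P {ω | x ≤ explainedNoise (fun i => ν i ω) n T}
      ≤ ENNReal.ofReal (expMoment d σ a ^ N * Real.exp (-(a * x))) := by
  refine (measure_le_sum_segments_le hlaw hind ha ha' x (prevChange T) (insert n T)
    (fun t ht => prevChange_lt T (pos_le_of_mem_insert hn hT ht).1)
    (fun t ht => (pos_le_of_mem_insert hn hT ht).2) (pairwiseDisjoint_segments hn hT)).trans ?_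
  refine ENNReal.ofReal_le_ofReal (mul_le_mul_of_nonneg_right ?_ (Real.exp_pos _).le)
  exact pow_le_pow_right₀ (one_le_expMoment ha ha') ((Finset.card_insert_le _ _).trans hN)

theorem measure_le_normSq_block_le
    (hlaw : ∀ i ∈ Finset.Icc 1 n, HasLaw (ν i)
      (multivariateGaussian 0 (σ ^ 2 • (1 : Matrix (Fin d) (Fin d) ℝ))) P)
    (hind : iIndepFun (fun i : Finset.Icc 1 n => ν (i : ℕ)) P)
    {a : ℝ} (ha : 0 ≤ a) (ha' : a * σ ^ 2 < 1 / 2) (x : ℝ) {s t : ℕ} (hst : s < t) (htn : t ≤ n) :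
    P {ω | x ≤ ((t : ℝ) - s)⁻¹ * ‖∑ i ∈ Finset.Ioc s t, ν i ω‖ ^ 2}
      ≤ ENNReal.ofReal (expMoment d σ a * Real.exp (-(a * x))) := by
  simpa using measure_le_sum_segments_le hlaw hind ha ha' x (fun _ => s) {t}
    (by simpa using hst) (by simpa using htn) (by simp)

/-- Union bound over all segmentations with `m` changepoints in given windows and a nonempty set of
further changepoints. -/
theorem measure_exists_le_explainedNoise_le {m w : ℕ}
    (hlaw : ∀ i ∈ Finset.Icc 1 n, HasLaw (ν i)
      (multivariateGaussian 0 (σ ^ 2 • (1 : Matrix (Fin d) (Fin d) ℝ))) P)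
    (hind : iIndepFun (fun i : Finset.Icc 1 n => ν (i : ℕ)) P)
    {a : ℝ} (ha : 0 ≤ a) (ha' : a * σ ^ 2 < 1 / 2) (β : ℝ) (hn : 0 < n)
    (W : Fin m → Finset ℕ) (hW : ∀ k, W k ⊆ Finset.Ioo 0 n) (hWcard : ∀ k, (W k).card ≤ w)
    {S₀ : Finset ℕ} (hS₀ : S₀ ⊆ Finset.Ioo 0 n) (hS₀card : S₀.card ≤ m) :
    P {ω | ∃ p ∈ Fintype.piFinset W, ∃ R ⊆ Finset.Ioo 0 n, R.Nonempty ∧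
        R.card * β ≤ explainedNoise (fun i => ν i ω) n ((Finset.univ.image p ∪ R) ∪ S₀)}
      ≤ ENNReal.ofReal ((w : ℝ) ^ m * expMoment d σ a ^ (2 * m + 1) *
          (Real.exp (n * (expMoment d σ a * Real.exp (-(a * β)))) - 1)) := by
  set C := expMoment d σ a with hC
  have hC1 : 1 ≤ C := one_le_expMoment ha ha'
  set q : ℝ := C * Real.exp (-(a * β)) with hq
  have hq0 : 0 ≤ q := by positivity
  set 𝓡 : Finset (Finset ℕ) := (Finset.Ioo 0 n).powerset.erase ∅ with h𝓡
  have hone : ∀ p ∈ Fintype.piFinset W, ∀ R ∈ 𝓡,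
      P {ω | R.card * β ≤ explainedNoise (fun i => ν i ω) n ((Finset.univ.image p ∪ R) ∪ S₀)}
        ≤ ENNReal.ofReal (C ^ (2 * m + 1) * q ^ R.card) := by
    intro p hp R hR
    have hRn : R ⊆ Finset.Ioo 0 n := Finset.mem_powerset.1 (Finset.mem_erase.1 hR).2
    have hpn : Finset.univ.image p ⊆ Finset.Ioo 0 n := by
      intro s hs
      obtain ⟨k, -, rfl⟩ := Finset.mem_image.1 hs
      exact hW k (Fintype.mem_piFinset.1 hp k)
    -- At most `m` points from `p`, `|R|` from `R` and `m` from `S₀`, plus one because segments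
    -- outnumber changes by one.
    have hcard : ((Finset.univ.image p ∪ R) ∪ S₀).card + 1 ≤ 2 * m + 1 + R.card := by
      have h1 := Finset.card_union_le (Finset.univ.image p ∪ R) S₀
      have h2 := Finset.card_union_le (Finset.univ.image p) R
      have h3 := Finset.card_image_le (s := (Finset.univ : Finset (Fin m))) (f := p)
      rw [Finset.card_univ, Fintype.card_fin] at h3
      omega
    refine (measure_le_explainedNoise_le hlaw hind ha ha' _ hn
      (Finset.union_subset (Finset.union_subset hpn hRn) hS₀) hcard).trans_eq ?_
    rw [← hC, pow_add, hq, mul_pow, ← Real.exp_nat_mul, mul_assoc]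
    congr 4
    ring
  -- By the binomial theorem the sum of `q^|R|` over all subsets is `(1 + q)^(n-1)`; leaving out `R
  -- = ∅` subtracts `1`, and this is what makes the bound vanish as `nq → 0`.
  have hsum : ∑ R ∈ 𝓡, q ^ R.card ≤ Real.exp (n * q) - 1 := by
    have h1 : ∑ R ∈ (Finset.Ioo 0 n).powerset, q ^ R.card = (q + 1) ^ (Finset.Ioo 0 n).card := by
      rw [← Finset.sum_pow_mul_eq_add_pow]
      simp
    have h2 := Finset.sum_erase_add (Finset.Ioo 0 n).powerset (fun R => q ^ R.card)
      (Finset.empty_mem_powerset _)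
    simp only [Finset.card_empty, pow_zero] at h2
    have h3 : (q + 1) ^ (Finset.Ioo 0 n).card ≤ Real.exp (n * q) := by
      rw [Real.exp_nat_mul]
      calc (q + 1) ^ (Finset.Ioo 0 n).card ≤ (q + 1) ^ n :=
            pow_le_pow_right₀ (by linarith) (by rw [Nat.card_Ioo]; omega)
        _ ≤ Real.exp q ^ n := pow_le_pow_left₀ (by linarith) (Real.add_one_le_exp q) n
    linarith
  have hpcard : ((Fintype.piFinset W).card : ℝ) ≤ (w : ℝ) ^ m := by
    rw [Fintype.card_piFinset]
    calc ((∏ k, (W k).card : ℕ) : ℝ) ≤ ((∏ _k : Fin m, w : ℕ) : ℝ) := by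
          exact_mod_cast Finset.prod_le_prod' fun k _ => hWcard k
      _ = (w : ℝ) ^ m := by simp
  have hcover : {ω | ∃ p ∈ Fintype.piFinset W, ∃ R ⊆ Finset.Ioo 0 n, R.Nonempty ∧
        R.card * β ≤ explainedNoise (fun i => ν i ω) n ((Finset.univ.image p ∪ R) ∪ S₀)}
      ⊆ ⋃ p ∈ Fintype.piFinset W, ⋃ R ∈ 𝓡,
        {ω | R.card * β ≤
          explainedNoise (fun i => ν i ω) n ((Finset.univ.image p ∪ R) ∪ S₀)} := by
    rintro ω ⟨p, hp, R, hR, hne, h⟩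
    simp only [Set.mem_iUnion]
    exact ⟨p, hp, R, Finset.mem_erase.2 ⟨hne.ne_empty, Finset.mem_powerset.2 hR⟩, h⟩
  calc _ ≤ _ := measure_mono hcover
    _ ≤ ∑ p ∈ Fintype.piFinset W, P (⋃ R ∈ 𝓡, {ω | R.card * β ≤
          explainedNoise (fun i => ν i ω) n ((Finset.univ.image p ∪ R) ∪ S₀)}) :=
        measure_biUnion_finset_le _ _
    _ ≤ ∑ p ∈ Fintype.piFinset W, ∑ R ∈ 𝓡, ENNReal.ofReal (C ^ (2 * m + 1) * q ^ R.card) :=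
        Finset.sum_le_sum fun p hp => (measure_biUnion_finset_le _ _).trans
          (Finset.sum_le_sum fun R hR => hone p hp R hR)
    _ = ENNReal.ofReal ((Fintype.piFinset W).card *
          (C ^ (2 * m + 1) * ∑ R ∈ 𝓡, q ^ R.card)) := by
        rw [Finset.sum_const, ← ENNReal.ofReal_sum_of_nonneg fun R _ => by positivity,
          ← Finset.mul_sum, ← ENNReal.ofReal_nsmul, nsmul_eq_mul]
    _ ≤ _ := by
        refine ENNReal.ofReal_le_ofReal ?_
        rw [mul_assoc]
        refine mul_le_mul hpcard (mul_le_mul_of_nonneg_left hsum (by positivity)) ?_ (by positivity)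
        exact mul_nonneg (by positivity) (Finset.sum_nonneg fun R _ => by positivity)

end Noise

/-! ### Growth rates of windows, penalties and error bounds. -/

section Asymptotics

theorem tendsto_log_natCast : Tendsto (fun n : ℕ => Real.log n) atTop atTop :=
  Real.tendsto_log_atTop.comp tendsto_natCast_atTop_atTop

theorem tendsto_log_rpow_div_rpow (r : ℝ) {s : ℝ} (hs : 0 < s) :
    Tendsto (fun n : ℕ => Real.log n ^ r / (n : ℝ) ^ s) atTop (𝓝 0) :=
  (isLittleO_log_rpow_rpow_atTop r hs).tendsto_div_nhds_zero.comp tendsto_natCast_atTop_atTop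

theorem tendsto_ceil_log_rpow {r : ℝ} (hr : 0 < r) :
    Tendsto (fun n : ℕ => ((⌈Real.log n ^ r⌉₊ : ℕ) : ℝ)) atTop atTop :=
  tendsto_atTop_mono (fun _ => Nat.le_ceil _) ((tendsto_rpow_atTop hr).comp tendsto_log_natCast)

theorem eventually_mul_log_lt_mul_ceil_log_rpow {α c : ℝ} (hα : 0 < α) (K : ℝ) (hc : 0 < c) :
    ∀ᶠ n : ℕ in atTop, K * Real.log n < c * (⌈Real.log n ^ (1 + α)⌉₊ : ℕ) := by
  filter_upwards [((tendsto_rpow_atTop hα).comp tendsto_log_natCast).eventually_gt_atTop (K / c),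
    tendsto_log_natCast.eventually_gt_atTop 0] with n h1 h2
  rw [Function.comp_apply, div_lt_iff₀ hc] at h1
  calc K * Real.log n < Real.log n ^ α * c * Real.log n := mul_lt_mul_of_pos_right h1 h2
    _ = c * Real.log n ^ (1 + α) := by rw [Real.rpow_add h2, Real.rpow_one]; ring
    _ ≤ _ := mul_le_mul_of_nonneg_left (Nat.le_ceil _) hc.le

theorem ceil_log_rpow_le (n : ℕ) (r : ℝ) :
    ((⌈Real.log n ^ r⌉₊ : ℕ) : ℝ) ≤ Real.log n ^ r + 1 :=
  (Nat.ceil_lt_add_one (Real.rpow_nonneg (Real.log_natCast_nonneg n) r)).le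

theorem eventually_trueChange_separated {m : ℕ} {θ : Fin (m + 2) → ℝ} (hθ : StrictMono θ)
    (hθ_zero : θ 0 = 0) (r : ℝ) :
    ∀ᶠ n : ℕ in atTop, ∀ k : Fin (m + 1),
      trueChange θ n k.castSucc + 2 * ⌈Real.log n ^ r⌉₊ < trueChange θ n k.succ := by
  rw [eventually_all]
  intro k
  have hgap : 0 < θ k.succ - θ k.castSucc := sub_pos.2 (hθ k.castSucc_lt_succ)
  have h0 : 0 ≤ θ k.castSucc := hθ_zero ▸ hθ.monotone (Fin.zero_le _)
  -- Twice the half-width is below `gap · n / 2 + 2` and the floor loses at most `1`, so `gap · n /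
  -- 2 > 3` suffices, which is `n > 6 / gap`.
  filter_upwards [(tendsto_log_rpow_div_rpow r one_pos).eventually_lt_const
      (by positivity : 0 < (θ k.succ - θ k.castSucc) / 4),
    (tendsto_natCast_atTop_atTop (R := ℝ)).eventually_gt_atTop (6 / (θ k.succ - θ k.castSucc)),
    eventually_gt_atTop 0] with n h1 h2 hn
  have hn' : (0 : ℝ) < n := by exact_mod_cast hn
  rw [Real.rpow_one, div_lt_iff₀ hn'] at h1
  rw [div_lt_iff₀ hgap] at h2
  have h3 := ceil_log_rpow_le n r
  have h4 : (trueChange θ n k.castSucc : ℝ) ≤ θ k.castSucc * n := Nat.floor_le (by positivity)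
  have h5 : θ k.succ * n < trueChange θ n k.succ + 1 := Nat.lt_floor_add_one _
  have : (trueChange θ n k.castSucc : ℝ) + 2 * (⌈Real.log n ^ r⌉₊ : ℕ) < trueChange θ n k.succ := by
    linarith
  exact_mod_cast this

/-- The exponential `exp(-κ log n)` is at most `n^(-1-η)`, so the bracket is `O(n^(-η))`, while the
window count grows only like a power of `log n`. -/
theorem tendsto_excess_bound {α η : ℝ} (hα : 0 < α) (hη : 0 < η) (m : ℕ) {C κ : ℝ} (hC : 0 ≤ C)
    (hκ : 1 + η ≤ κ) :
    Tendsto (fun n : ℕ => (((2 * ⌈Real.log n ^ (1 + α)⌉₊ + 1 : ℕ) : ℝ)) ^ m * C ^ (2 * m + 1) *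
      (Real.exp (n * (C * Real.exp (-(κ * Real.log n)))) - 1)) atTop (𝓝 0) := by
  have hlim := (tendsto_log_rpow_div_rpow ((1 + α) * m) hη).const_mul
    (5 ^ m * C ^ (2 * m + 1) * (2 * C))
  rw [mul_zero] at hlim
  refine tendsto_of_tendsto_of_tendsto_of_le_of_le' tendsto_const_nhds hlim ?_ ?_
  · refine Eventually.of_forall fun n => mul_nonneg (by positivity) ?_
    exact sub_nonneg.2 (Real.one_le_exp (by positivity))
  · have hsmall := (tendsto_log_rpow_div_rpow 0 hη).const_mul C
    rw [mul_zero] at hsmall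
    filter_upwards [tendsto_log_natCast.eventually_ge_atTop 1, eventually_gt_atTop 0,
      hsmall.eventually_le_const one_pos] with n hlog hn hs
    have hn' : (0 : ℝ) < n := by exact_mod_cast hn
    rw [Real.rpow_zero] at hs
    have hu : n * (C * Real.exp (-(κ * Real.log n))) ≤ C * (1 / (n : ℝ) ^ η) := by
      have h1 : Real.exp (-(κ * Real.log n)) ≤ ((n : ℝ) * (n : ℝ) ^ η)⁻¹ := by
        rw [← Real.rpow_one_add' hn'.le (by linarith), ← Real.rpow_neg hn'.le,
          Real.rpow_def_of_pos hn', Real.exp_le_exp]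
        nlinarith
      calc n * (C * Real.exp (-(κ * Real.log n))) ≤ n * (C * ((n : ℝ) * (n : ℝ) ^ η)⁻¹) := by
            gcongr
        _ = C * (1 / (n : ℝ) ^ η) := by field_simp
    set u := n * (C * Real.exp (-(κ * Real.log n))) with hudef
    have hu0 : 0 ≤ u := by positivity
    have hexp : Real.exp u - 1 ≤ 2 * (C * (1 / (n : ℝ) ^ η)) := by
      have := Real.abs_exp_sub_one_le (x := u) (by rw [abs_of_nonneg hu0]; linarith)
      rw [abs_of_nonneg hu0] at this
      have := le_abs_self (Real.exp u - 1)
      linarith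
    have hr : 1 ≤ Real.log n ^ (1 + α) := Real.one_le_rpow hlog (by linarith)
    -- For `x ≥ 1`, `2⌈x⌉ + 1 ≤ 2x + 3 ≤ 5x`.
    have hw : ((2 * ⌈Real.log n ^ (1 + α)⌉₊ + 1 : ℕ) : ℝ) ^ m
        ≤ 5 ^ m * Real.log n ^ ((1 + α) * m) := by
      rw [Real.rpow_mul (by linarith), Real.rpow_natCast, ← mul_pow]
      refine pow_le_pow_left₀ (by positivity) ?_ m
      have := ceil_log_rpow_le n (1 + α)
      push_cast
      linarith
    calc _ ≤ 5 ^ m * Real.log n ^ ((1 + α) * m) * C ^ (2 * m + 1) *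
          (2 * (C * (1 / (n : ℝ) ^ η))) := by
          gcongr
          exact sub_nonneg.2 (Real.one_le_exp hu0)
      _ = _ := by ring

end Asymptotics

end Changepoint

/-! ### Assembly of the consistency theorem. -/

open Changepoint in
theorem mainTheorem5
    {d m : ℕ} (hd : 1 ≤ d)
    -- the proportions `0 = θ_0 < θ_1 < … < θ_m < θ_{m+1} = 1` of the changes
    (θ : Fin (m + 2) → ℝ) (hθ : StrictMono θ) (hθ_zero : θ 0 = 0) (hθ_one : θ (Fin.last (m + 1)) = 1)
    -- the means of the segments
    (mean : Fin (m + 1) → EuclideanSpace ℝ (Fin d))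
    (hmean : ∀ k : Fin m, mean k.castSucc ≠ mean k.succ)
    (σ : ℝ) (hσ : 0 < σ)
    -- for each length `n` a probability space with i.i.d. noise `N_d(0, σ² I)` at times `1, …, n`
    {Ω : ℕ → Type*} [∀ n, MeasurableSpace (Ω n)]
    (P : ∀ n, Measure (Ω n)) [∀ n, IsProbabilityMeasure (P n)]
    (noise : ∀ n, ℕ → Ω n → EuclideanSpace ℝ (Fin d))
    (hlaw : ∀ n, ∀ i ∈ Finset.Icc 1 n,
      HasLaw (noise n i)
        (multivariateGaussian 0 (σ ^ 2 • (1 : Matrix (Fin d) (Fin d) ℝ))) (P n))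
    (hindep : ∀ n, iIndepFun (fun i : Finset.Icc 1 n => noise n (i : ℕ)) (P n))
    -- the observed series of length `n`
    (Y : ∀ n, Ω n → ℕ → EuclideanSpace ℝ (Fin d))
    (hY : ∀ n, ∀ k : Fin (m + 1), ∀ i : ℕ,
      Changepoint.trueChange θ n k.castSucc + 1 ≤ i → i ≤ Changepoint.trueChange θ n k.succ →
        ∀ ω, Y n ω i = noise n i ω + mean k)
    -- the penalty constants; `v` is the noise variance or an upper bound for it
    (ε v α : ℝ) (hε : 0 < ε) (hv : σ ^ 2 ≤ v) (hα : 0 < α)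
    -- the set of estimated changepoints, produced by exact minimisation
    (est : ∀ n, Ω n → Finset ℕ)
    (hest : ∀ n, ∀ ω,
      Changepoint.IsExactMinimiser (Y n ω) n
        (v * (((d : ℝ) + 1) * (1 + ε) * Real.log (n : ℝ))) (est n ω)) :
    Tendsto (fun n => P n {ω | Changepoint.IsAccurate θ α n (est n ω)}) atTop (𝓝 1) ∧
      Tendsto (fun n => P n {ω | Changepoint.IsAccurate θ α n (est n ω)}ᶜ) atTop (𝓝 0) := by
  have hσ2 : 0 < σ ^ 2 := by positivity
  have hv0 : 0 < v := hσ2.trans_le hv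
  -- the Chernoff exponent: subcritical, yet large enough for the penalty to beat the entropy
  set a : ℝ := (1 + ε / 2) / (2 * (1 + ε)) / σ ^ 2 with ha_def
  have ha : 0 ≤ a := by positivity
  have haσ : a * σ ^ 2 = (1 + ε / 2) / (2 * (1 + ε)) := div_mul_cancel₀ _ hσ2.ne'
  have ha' : a * σ ^ 2 < 1 / 2 := by
    rw [haσ, div_lt_div_iff₀ (by positivity) (by norm_num)]
    linarith
  set K : ℝ := v * ((d + 1) * (1 + ε)) with hK
  have hK0 : 0 < K := by positivity
  -- The surplus over `1` that the union bound over positions needs: `v ≥ σ²` and `d + 1 ≥ 2` give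
  -- `K ≥ 2σ²(1 + ε)`, and `a` times the latter is exactly `1 + ε/2`.
  have hκ : 1 + ε / 2 ≤ a * K := by
    have hd' : (1 : ℝ) ≤ d := by exact_mod_cast hd
    calc 1 + ε / 2 = a * σ ^ 2 * (2 * (1 + ε)) := by rw [haσ]; field_simp
      _ = a * (σ ^ 2 * (2 * (1 + ε))) := by ring
      _ ≤ a * (v * ((d + 1) * (1 + ε))) := by
          refine mul_le_mul_of_nonneg_left (mul_le_mul hv ?_ (by positivity) hv0.le) ha
          exact mul_le_mul_of_nonneg_right (by linarith) (by positivity)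
  set C := expMoment d σ a with hC
  have hC1 : 1 ≤ C := one_le_expMoment ha ha'
  set L : ℕ → ℕ := fun n => ⌈Real.log n ^ (1 + α)⌉₊ with hLdef
  set δ : Fin m → ℝ := fun k => ‖mean k.castSucc - mean k.succ‖ / 4 with hδ
  have hδ0 : ∀ k, 0 < δ k := fun k => div_pos (norm_sub_pos_iff.2 (hmean k)) (by norm_num)
  -- The first term bounds the probability of superfluous changes; the second that of large noise in
  -- one of the two blocks beside some true change.
  set b : ℕ → ℝ := fun n =>
    ((2 * L n + 1 : ℕ) : ℝ) ^ m * C ^ (2 * m + 1) *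
      (Real.exp (n * (C * Real.exp (-((a * K) * Real.log n)))) - 1)
    + ∑ k : Fin m, 2 * (C * Real.exp (-(a * (L n * δ k ^ 2)))) with hb
  have hblim : Tendsto b atTop (𝓝 0) := by
    have h1 := tendsto_excess_bound hα (half_pos hε) m (by linarith : 0 ≤ C) hκ
    have h2 : Tendsto (fun n => ∑ k : Fin m, 2 * (C * Real.exp (-(a * (L n * δ k ^ 2))))) atTop
        (𝓝 (∑ _k : Fin m, 2 * (C * 0))) := by
      refine tendsto_finsetSum _ fun k _ => ((Tendsto.const_mul C ?_).const_mul 2)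
      refine Real.tendsto_exp_neg_atTop_nhds_zero.comp ?_
      have ha0 : 0 < a := by positivity
      exact ((tendsto_ceil_log_rpow (by linarith : 0 < 1 + α)).atTop_mul_const
        (pow_pos (hδ0 k) 2)).const_mul_atTop ha0
    have h := h1.add h2
    simp only [mul_zero, Finset.sum_const_zero, add_zero] at h
    exact h
  have hbound : ∀ᶠ n in atTop,
      P n {ω | IsAccurate θ α n (est n ω)}ᶜ ≤ ENNReal.ofReal (b n) := by
    have hgain : ∀ᶠ n : ℕ in atTop, ∀ k : Fin m,
        3 * K * Real.log n < (1 / 8 * ‖mean k.castSucc - mean k.succ‖ ^ 2) * (L n : ℝ) := by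
      rw [eventually_all]
      intro k
      have := norm_sub_pos_iff.2 (hmean k)
      exact eventually_mul_log_lt_mul_ceil_log_rpow hα (3 * K) (by positivity)
    filter_upwards [eventually_trueChange_separated hθ hθ_zero (1 + α), hgain,
      (tendsto_ceil_log_rpow (by linarith : 0 < 1 + α)).eventually_gt_atTop 0]
      with n hsep hgain hL
    replace hL : 0 < L n := by exact_mod_cast hL
    replace hsep : ∀ k : Fin (m + 1),
      trueChange θ n k.castSucc + 2 * L n < trueChange θ n k.succ := hsep
    set β : ℝ := v * (((d : ℝ) + 1) * (1 + ε) * Real.log n) with hβ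
    have hβK : β = K * Real.log n := by rw [hβ, hK]; ring
    have hβ0 : 0 ≤ β := by
      rw [hβK]; exact mul_nonneg hK0.le (Real.log_natCast_nonneg n)
    set τ : Fin (m + 2) → ℕ := trueChange θ n with hτ
    have hτ0 : τ 0 = 0 := by simp [hτ, trueChange, hθ_zero]
    have hτn : τ (Fin.last (m + 1)) = n := by simp [hτ, trueChange, hθ_one]
    have hmono : StrictMono τ := Fin.strictMono_iff_lt_succ.2 fun k => by
      have := hsep k
      omega
    have hsep₁ : ∀ k : Fin m, 2 * L n < τ k.succ.castSucc := fun k => by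
      have := hsep k.castSucc
      rw [Fin.succ_castSucc] at this
      omega
    have hsep₂ : ∀ k : Fin m, τ k.succ.castSucc + 2 * L n < n := fun k =>
      (hsep k.succ).trans_le (hτn ▸ hmono.monotone (Fin.le_last _))
    have hn : 0 < n := by
      have := hsep 0
      have := hτn ▸ hmono.monotone (Fin.le_last (Fin.succ 0))
      omega
    set S₀ : Finset ℕ := Finset.univ.image fun k : Fin m => τ k.succ.castSucc with hS₀def
    set W : Fin m → Finset ℕ := fun k =>
      Finset.Icc (τ k.succ.castSucc - L n) (τ k.succ.castSucc + L n) with hW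
    set E₁ : Set (Ω n) := {ω | ∃ p ∈ Fintype.piFinset W, ∃ R ⊆ Finset.Ioo 0 n, R.Nonempty ∧
        R.card * β ≤ explainedNoise (fun i => noise n i ω) n ((Finset.univ.image p ∪ R) ∪ S₀)}
    set E₂ : Fin m → Set (Ω n) := fun k => {ω | (L n : ℝ) * δ k ^ 2 ≤ (L n : ℝ)⁻¹ *
      ‖∑ i ∈ Finset.Ioc (τ k.succ.castSucc - L n) (τ k.succ.castSucc), noise n i ω‖ ^ 2}
    set E₃ : Fin m → Set (Ω n) := fun k => {ω | (L n : ℝ) * δ k ^ 2 ≤ (L n : ℝ)⁻¹ *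
      ‖∑ i ∈ Finset.Ioc (τ k.succ.castSucc) (τ k.succ.castSucc + L n), noise n i ω‖ ^ 2}
    have hcover : {ω | IsAccurate θ α n (est n ω)}ᶜ ⊆ E₁ ∪ ⋃ k ∈ Finset.univ, (E₂ k ∪ E₃ k) := by
      intro ω hω
      by_contra hcon
      simp only [Set.mem_union, Set.mem_iUnion, not_or, not_exists] at hcon
      obtain ⟨hc₁, hc₂⟩ := hcon
      refine hω ?_
      obtain ⟨hcard, hacc⟩ := (hest n ω).exists_card_eq_of_noise_bounds hL hτ0 hτn hsep
        (ν := fun i => noise n i ω) (fun k i h1 h2 => hY n k i h1 h2 ω) hβ0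
        (fun k => by have := hgain k; rw [hβK]; linarith)
        (fun k => not_le.1 fun h => (hc₂ k (Finset.mem_univ k)).1 h)
        (fun k => not_le.1 fun h => (hc₂ k (Finset.mem_univ k)).2 h)
        (fun p hp R hR hne => not_le.1 fun h => hc₁ ⟨p, hp, R, hR, hne, h⟩)
      refine ⟨hcard, fun k => (hacc k).trans_eq ?_⟩
      -- The natural-number ceiling in `L` equals the integer ceiling because the power of `log n`
      -- is nonnegative.
      exact Int.natCast_ceil_eq_ceil (Real.rpow_nonneg (Real.log_natCast_nonneg n) _)
    have h₁ : P n E₁ ≤ ENNReal.ofReal (((2 * L n + 1 : ℕ) : ℝ) ^ m * C ^ (2 * m + 1) *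
        (Real.exp (n * (C * Real.exp (-((a * K) * Real.log n)))) - 1)) := by
      rw [mul_assoc a K, ← hβK]
      refine measure_exists_le_explainedNoise_le (hlaw n) (hindep n) ha ha' β hn W
        (fun k s hs => ?_) (fun k => ?_) (fun s hs => ?_) ?_
      · have := hsep₁ k
        have := hsep₂ k
        rw [Finset.mem_Icc] at hs
        rw [Finset.mem_Ioo]
        omega
      · rw [Nat.card_Icc]
        omega
      · obtain ⟨k, -, rfl⟩ := Finset.mem_image.1 hs
        have := hsep₁ k
        have := hsep₂ k
        rw [Finset.mem_Ioo]
        omega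
      · exact Finset.card_image_le.trans_eq (by simp)
    have h₂ : ∀ k, P n (E₂ k) ≤ ENNReal.ofReal (C * Real.exp (-(a * (L n * δ k ^ 2)))) := by
      intro k
      have := hsep₁ k
      have := hsep₂ k
      have h := measure_le_normSq_block_le (hlaw n) (hindep n) ha ha' (L n * δ k ^ 2)
        (s := τ k.succ.castSucc - L n) (t := τ k.succ.castSucc) (by omega) (by omega)
      rwa [Nat.cast_sub (by omega), sub_sub_cancel] at h
    have h₃ : ∀ k, P n (E₃ k) ≤ ENNReal.ofReal (C * Real.exp (-(a * (L n * δ k ^ 2)))) := by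
      intro k
      have := hsep₂ k
      have h := measure_le_normSq_block_le (hlaw n) (hindep n) ha ha' (L n * δ k ^ 2)
        (s := τ k.succ.castSucc) (t := τ k.succ.castSucc + L n) (by omega) (by omega)
      rwa [Nat.cast_add, add_sub_cancel_left] at h
    have hnonneg : 0 ≤ ((2 * L n + 1 : ℕ) : ℝ) ^ m * C ^ (2 * m + 1) *
        (Real.exp (n * (C * Real.exp (-((a * K) * Real.log n)))) - 1) :=
      mul_nonneg (by positivity) (sub_nonneg.2 (Real.one_le_exp (by positivity)))
    calc P n {ω | IsAccurate θ α n (est n ω)}ᶜ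
        ≤ P n E₁ + ∑ k : Fin m, P n (E₂ k ∪ E₃ k) :=
          (measure_mono hcover).trans ((measure_union_le _ _).trans
            (add_le_add_right (measure_biUnion_finset_le _ _) _))
      _ ≤ ENNReal.ofReal (((2 * L n + 1 : ℕ) : ℝ) ^ m * C ^ (2 * m + 1) *
            (Real.exp (n * (C * Real.exp (-((a * K) * Real.log n)))) - 1))
          + ∑ k : Fin m, ENNReal.ofReal (2 * (C * Real.exp (-(a * (L n * δ k ^ 2))))) := by
          refine add_le_add h₁ (Finset.sum_le_sum fun k _ => ?_)
          rw [two_mul, ENNReal.ofReal_add (by positivity) (by positivity)]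
          exact (measure_union_le _ _).trans (add_le_add (h₂ k) (h₃ k))
      _ = ENNReal.ofReal (b n) := by
          rw [← ENNReal.ofReal_sum_of_nonneg fun k _ => by positivity,
            ← ENNReal.ofReal_add hnonneg (Finset.sum_nonneg fun k _ => by positivity)]
  have hcompl : Tendsto (fun n => P n {ω | IsAccurate θ α n (est n ω)}ᶜ) atTop (𝓝 0) := by
    have h := ENNReal.tendsto_ofReal hblim
    rw [ENNReal.ofReal_zero] at h
    exact tendsto_of_tendsto_of_tendsto_of_le_of_le' tendsto_const_nhds h
      (Eventually.of_forall fun _ => zero_le) hbound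
  refine ⟨?_, hcompl⟩
  have h := ENNReal.Tendsto.sub (tendsto_const_nhds (x := (1 : ENNReal)) (f := atTop)) hcompl
    (Or.inl ENNReal.one_ne_top)
  rw [tsub_zero] at h
  refine tendsto_of_tendsto_of_tendsto_of_le_of_le h tendsto_const_nhds (fun n => ?_)
    fun n => prob_le_one
  -- Subadditivity gives `1 ≤ P(A) + P(Aᶜ)` without measurability of the event, which arbitrary
  -- tie-breaking in `est` need not provide.
  rw [tsub_le_iff_right, ← measure_univ (μ := P n), ← Set.union_compl_self
    {ω | IsAccurate θ α n (est n ω)}]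
  exact measure_union_le _ _
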